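/- Let $M$ be a smooth (Hausdorff, second countable) manifold of dimension $2n+1$, $n\ge 0$, with a regular almost-cosymplectic-contact structure $(\omega,\Omega)$: $\omega$ is a smooth 1-form, $\Omega$ a smooth 2-form, $d\Omega=0$, and $\omega\wedge\Omega^n$ vanishes nowhere. Put $\Omega^\flat(v)=i_v\Omega$. Let $(E,\Lambda)$ be the dual pair: $E$ is a smooth vector field and $\Lambda$ a smooth skew-symmetric 2-vector field such that, with $\alpha^\sharp=\Lambda^\sharp(\alpha)$ defined by $\beta(\alpha^\sharp)=\Lambda(\alpha,\beta)$, $$(\Omega^\flat|_{\operatorname{im}\Lambda^\sharp})^{-1}=\Lambda^\sharp|_{\operatorname{im}\Omega^\flat},\qquad i_E\omega=1,\qquad i_E\Omega=0,\qquad i_\omega\Lambda=0 .$$ For a smooth 1-form $\alpha$ and a smooth function $h$ on $M$ put $X_{(\alpha,h)}=\alpha^\sharp+hE$. For pairs $(\alpha_1,h_1),(\alpha_2,h_2)\in\Omega^1(M)\times C^\infty(M)$ define $$\begin{aligned}\beta={}&d\big(\Lambda(\alpha_1,\alpha_2)\big)-i_{\alpha_2^\sharp}d\alpha_1+i_{\alpha_1^\sharp}d\alpha_2+\alpha_1(E)\,i_{\alpha_2^\sharp}d\omega-\alpha_2(E)\,i_{\alpha_1^\sharp}d\omega\\&+h_1\big(L_E\alpha_2-\alpha_2(E)L_E\omega\big)-h_2\big(L_E\alpha_1-\alpha_1(E)L_E\omega\big),\\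 g={}&\alpha_1^\sharp.h_2-\alpha_2^\sharp.h_1-d\omega(\alpha_1^\sharp,\alpha_2^\sharp)+h_1\big(E.h_2+\Lambda(L_E\omega,\alpha_2)\big)-h_2\big(E.h_1+\Lambda(L_E\omega,\alpha_1)\big).\end{aligned}$$ Then: 1. $[X_{(\alpha_1,h_1)},X_{(\alpha_2,h_2)}]=\beta^\sharp+g\,E$. 2. $[\![(\alpha_1,h_1);(\alpha_2,h_2)]\!]:=(\beta;g)$ takes values in $\Omega^1(M)\times C^\infty(M)$ and is a real Lie algebra bracket there (bilinear, alternating, satisfying the Jacobi identity). It is compatible with restriction to open subsets: on an open set $U$ it depends only on the restrictions of the two pairs to $U$. Moreover $$X_{[\![(\alpha_1,h_1);(\alpha_2,h_2)]\!]}=[X_{(\alpha_1,h_1)},X_{(\alpha_2,h_2)}].$$ -/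

import Mathlib

open scoped Manifold ContDiff

noncomputable section

namespace AlmostCosymplecticContact

/-- Smooth vector fields on an `m`-dimensional manifold `M`. -/
abbrev VectorField (m : ℕ) (M : Type*) [TopologicalSpace M]
    [ChartedSpace (EuclideanSpace ℝ (Fin m)) M] [IsManifold (𝓡 m) ∞ M] :=
  ContMDiffSection (𝓡 m) (EuclideanSpace ℝ (Fin m)) ∞ (fun x : M => TangentSpace (𝓡 m) x)

/-- Smooth 1-forms on `M`. -/
abbrev OneForm (m : ℕ) (M : Type*) [TopologicalSpace M]
    [ChartedSpace (EuclideanSpace ℝ (Fin m)) M] [IsManifold (𝓡 m) ∞ M] :=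
  ContMDiffSection (𝓡 m) (EuclideanSpace ℝ (Fin m) →L[ℝ] ℝ) ∞
    (fun x : M => TangentSpace (𝓡 m) x →L[ℝ] ℝ)

/-- Smooth real functions on `M`. -/
abbrev SmoothFun (m : ℕ) (M : Type*) [TopologicalSpace M]
    [ChartedSpace (EuclideanSpace ℝ (Fin m)) M] :=
  ContMDiffMap (𝓡 m) 𝓘(ℝ, ℝ) M ℝ ∞

/-- Pairs `(α, h)` of a smooth 1-form and a smooth function, an `ℝ`-vector space. -/
abbrev FormFunPair (m : ℕ) (M : Type*) [TopologicalSpace M]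
    [ChartedSpace (EuclideanSpace ℝ (Fin m)) M] [IsManifold (𝓡 m) ∞ M] :=
  OneForm m M × SmoothFun m M

/-- Smooth 2-forms on `M`: smooth sections of `T*M ⊗ T*M` with alternating values.
The musical morphism is `Ω♭(v) = i_v Ω = Ω(v, ·)`. -/
structure TwoForm (m : ℕ) (M : Type*) [TopologicalSpace M]
    [ChartedSpace (EuclideanSpace ℝ (Fin m)) M] [IsManifold (𝓡 m) ∞ M] where
  flat : ContMDiffSection (𝓡 m)
    (EuclideanSpace ℝ (Fin m) →L[ℝ] EuclideanSpace ℝ (Fin m) →L[ℝ] ℝ) ∞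
    (fun x : M => TangentSpace (𝓡 m) x →L[ℝ] TangentSpace (𝓡 m) x →L[ℝ] ℝ)
  alternating : ∀ (x : M) (v : TangentSpace (𝓡 m) x), flat x v v = 0

/-- Smooth skew-symmetric 2-vector fields `Λ` on `M`. Since tangent spaces are finite dimensional,
`Λ` is the same thing as its musical morphism `Λ♯ : T*M → TM`, `β (Λ♯ α) = Λ(α, β)`,
and it is stored in this form. -/
structure Bivector (m : ℕ) (M : Type*) [TopologicalSpace M]
    [ChartedSpace (EuclideanSpace ℝ (Fin m)) M] [IsManifold (𝓡 m) ∞ M] where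
  sharp : ContMDiffSection (𝓡 m)
    ((EuclideanSpace ℝ (Fin m) →L[ℝ] ℝ) →L[ℝ] EuclideanSpace ℝ (Fin m)) ∞
    (fun x : M => (TangentSpace (𝓡 m) x →L[ℝ] ℝ) →L[ℝ] TangentSpace (𝓡 m) x)
  skew : ∀ (x : M) (α β : TangentSpace (𝓡 m) x →L[ℝ] ℝ), β (sharp x α) = - α (sharp x β)

section Calculus

variable {m : ℕ} {M : Type*} [TopologicalSpace M]
  [ChartedSpace (EuclideanSpace ℝ (Fin m)) M] [IsManifold (𝓡 m) ∞ M]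

/-- The value `Λ(α, β)` of a 2-vector field on two covectors at `x`. -/
def Bivector.eval (Λ : Bivector m M) (x : M) (α β : TangentSpace (𝓡 m) x →L[ℝ] ℝ) : ℝ :=
  β (Λ.sharp x α)

/-- The differential of a real function, as a field of covectors. -/
def dFun (f : M → ℝ) (x : M) : TangentSpace (𝓡 m) x →L[ℝ] ℝ :=
  mfderiv (𝓡 m) 𝓘(ℝ, ℝ) f x

/-- The exterior derivative of a 1-form at `x`, computed in the chart at `x`: if `a` is the
coordinate expression of `α`, then `dα(u, v) = (D_u a)(v) - (D_v a)(u)`. -/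
def dOne (α : OneForm m M) (x : M) :
    TangentSpace (𝓡 m) x →L[ℝ] TangentSpace (𝓡 m) x →L[ℝ] ℝ :=
  let φ := extChartAt (𝓡 m) x
  let a : EuclideanSpace ℝ (Fin m) → EuclideanSpace ℝ (Fin m) →L[ℝ] ℝ := fun y =>
    (α (φ.symm y)).comp (mfderiv 𝓘(ℝ, EuclideanSpace ℝ (Fin m)) (𝓡 m) φ.symm y)
  let D : EuclideanSpace ℝ (Fin m) →L[ℝ] EuclideanSpace ℝ (Fin m) →L[ℝ] ℝ := fderiv ℝ a (φ x)
  let L : EuclideanSpace ℝ (Fin m) →L[ℝ] EuclideanSpace ℝ (Fin m) :=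
    mfderiv (𝓡 m) 𝓘(ℝ, EuclideanSpace ℝ (Fin m)) φ x
  ((D - D.flip).bilinearComp L L :
    EuclideanSpace ℝ (Fin m) →L[ℝ] EuclideanSpace ℝ (Fin m) →L[ℝ] ℝ)

/-- The exterior derivative of a 2-form at `x`, computed in the chart at `x`: if `b` is the
coordinate expression of `Ω`, then
`dΩ(u, v, w) = (D_u b)(v, w) - (D_v b)(u, w) + (D_w b)(u, v)`. -/
def dTwo (Ω : TwoForm m M) (x : M) (u v w : TangentSpace (𝓡 m) x) : ℝ :=
  let φ := extChartAt (𝓡 m) x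
  let T : EuclideanSpace ℝ (Fin m) → EuclideanSpace ℝ (Fin m) → EuclideanSpace ℝ (Fin m) → ℝ :=
    fun v' w' y =>
      Ω.flat (φ.symm y) (mfderiv 𝓘(ℝ, EuclideanSpace ℝ (Fin m)) (𝓡 m) φ.symm y v')
        (mfderiv 𝓘(ℝ, EuclideanSpace ℝ (Fin m)) (𝓡 m) φ.symm y w')
  let L : TangentSpace (𝓡 m) x →L[ℝ] EuclideanSpace ℝ (Fin m) :=
    mfderiv (𝓡 m) 𝓘(ℝ, EuclideanSpace ℝ (Fin m)) φ x
  fderiv ℝ (T (L v) (L w)) (φ x) (L u) - fderiv ℝ (T (L u) (L w)) (φ x) (L v)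
    + fderiv ℝ (T (L u) (L v)) (φ x) (L w)

/-- The Lie derivative `L_X α = i_X dα + d(i_X α)` of a 1-form. -/
def lieDer (X : VectorField m M) (α : OneForm m M) (x : M) : TangentSpace (𝓡 m) x →L[ℝ] ℝ :=
  dOne α x (X x) + dFun (fun y => α y (X y)) x

/-- The vector field `X_{(α, h)} = α♯ + h E` generated by a pair `(α, h)`. -/
def genField (E : VectorField m M) (Λ : Bivector m M) (p : FormFunPair m M) (x : M) :
    TangentSpace (𝓡 m) x :=
  Λ.sharp x (p.1 x) + p.2 x • E x

/-- The 1-form component of the bracket of two pairs `p = (α₁, h₁)`, `q = (α₂, h₂)`. -/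
def bracketForm (ω₀ : OneForm m M) (E : VectorField m M) (Λ : Bivector m M)
    (p q : FormFunPair m M) (x : M) : TangentSpace (𝓡 m) x →L[ℝ] ℝ :=
  dFun (fun y => Λ.eval y (p.1 y) (q.1 y)) x
    - dOne p.1 x (Λ.sharp x (q.1 x))
    + dOne q.1 x (Λ.sharp x (p.1 x))
    + p.1 x (E x) • dOne ω₀ x (Λ.sharp x (q.1 x))
    - q.1 x (E x) • dOne ω₀ x (Λ.sharp x (p.1 x))
    + p.2 x • (lieDer E q.1 x - q.1 x (E x) • lieDer E ω₀ x)
    - q.2 x • (lieDer E p.1 x - p.1 x (E x) • lieDer E ω₀ x)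

/-- The function component of the bracket of two pairs `p = (α₁, h₁)`, `q = (α₂, h₂)`. -/
def bracketFun (ω₀ : OneForm m M) (E : VectorField m M) (Λ : Bivector m M)
    (p q : FormFunPair m M) (x : M) : ℝ :=
  dFun q.2 x (Λ.sharp x (p.1 x)) - dFun p.2 x (Λ.sharp x (q.1 x))
    - dOne ω₀ x (Λ.sharp x (p.1 x)) (Λ.sharp x (q.1 x))
    + p.2 x * (dFun q.2 x (E x) + Λ.eval x (lieDer E ω₀ x) (q.1 x))
    - q.2 x * (dFun p.2 x (E x) + Λ.eval x (lieDer E ω₀ x) (p.1 x))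

end Calculus

section Structures

variable {n : ℕ} {M : Type*} [TopologicalSpace M]
  [ChartedSpace (EuclideanSpace ℝ (Fin (2 * n + 1))) M] [IsManifold (𝓡 (2 * n + 1)) ∞ M]

/-- The value of `2ⁿ • (ω ∧ Ωⁿ)` on tangent vectors `v₀, …, v₂ₙ` at `x`, with the wedge product
written out as an antisymmetrized product over all permutations. -/
def volForm (ω₀ : OneForm (2 * n + 1) M) (Ω : TwoForm (2 * n + 1) M) (x : M)
    (v : Fin (2 * n + 1) → TangentSpace (𝓡 (2 * n + 1)) x) : ℝ :=
  ∑ σ : Equiv.Perm (Fin (2 * n + 1)), ((Equiv.Perm.sign σ : ℤ) : ℝ) *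
    (ω₀ x (v (σ ⟨0, by omega⟩)) *
      ∏ i : Fin n, Ω.flat x (v (σ ⟨2 * i.1 + 1, by omega⟩)) (v (σ ⟨2 * i.1 + 2, by omega⟩)))

/-- `(ω, Ω)` is a (regular) almost-cosymplectic-contact pair on a manifold of dimension `2n + 1`:
`dΩ = 0`, and `ω ∧ Ωⁿ` vanishes at no point. -/
structure IsAlmostCosymplecticContact (ω₀ : OneForm (2 * n + 1) M) (Ω : TwoForm (2 * n + 1) M) :
    Prop where
  closed : ∀ (x : M) (u v w : TangentSpace (𝓡 (2 * n + 1)) x), dTwo Ω x u v w = 0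
  regular : ∀ x : M, ∃ v : Fin (2 * n + 1) → TangentSpace (𝓡 (2 * n + 1)) x, volForm ω₀ Ω x v ≠ 0

end Structures

section Duality

variable {m : ℕ} {M : Type*} [TopologicalSpace M]
  [ChartedSpace (EuclideanSpace ℝ (Fin m)) M] [IsManifold (𝓡 m) ∞ M]

/-- `(E, Λ)` is the pair dual to `(ω, Ω)`: the restrictions of `Ω♭` to `im Λ♯` and of `Λ♯` to
`im Ω♭` are mutually inverse, `i_E ω = 1`, `i_E Ω = 0`, `i_ω Λ = 0`. -/
structure IsDualPair (ω₀ : OneForm m M) (Ω : TwoForm m M) (E : VectorField m M)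
    (Λ : Bivector m M) : Prop where
  left_inv : ∀ (x : M), ∀ v ∈ Set.range (Λ.sharp x), Λ.sharp x (Ω.flat x v) = v
  right_inv : ∀ (x : M), ∀ α ∈ Set.range (Ω.flat x), Ω.flat x (Λ.sharp x α) = α
  omega_E : ∀ x : M, ω₀ x (E x) = 1
  Omega_E : ∀ x : M, Ω.flat x (E x) = 0
  Lambda_omega : ∀ x : M, Λ.sharp x (ω₀ x) = 0

end Duality

end AlmostCosymplecticContact

end

/-! Regularity makes `ω` and `Ω♭` jointly injective on each tangent space, since a common kernel
vector would kill the top-degree form `ω ∧ Ωⁿ`. Hence every tangent vector splits as `v = (Ω♭ v)♯ +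
ω(v) E` (`IsDualPair.sharp_flat`), and dually `Ω♭(α♯) = α - α(E) ω` (`IsDualPair.flat_sharp`). To
find `[X_p, X_q]` it is enough to contract it with `ω` and with `Ω`. Cartan's formula for `dω` gives
`g`; Cartan's formula for the closed form `Ω` gives `β - c ω` with `c = X_p.(α₂(E)) - X_q.(α₁(E))`.
Since `ω♯ = 0`, the first claim follows.

For the Lie algebra, `X_{(α, h)}` alone forgets `α(E)`, but the map `(α, h) ↦ (X_{(α, h)}, α(E))` is
injective (`IsDualPair.pair_ext`). It carries the bracket of pairs to `([X, Y], X.f₂ - Y.f₁)`, the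
bracket of the semidirect product of vector fields with functions
(`IsDualPair.pairField_pairBracket`, `IsDualPair.reebPart_pairBracket`). Bilinearity, alternation
and Jacobi are pulled back along this injection. -/

noncomputable section

namespace AlmostCosymplecticContact

open _root_.VectorField

/-! ### Smooth tensor operations bundled as sections. -/

section Sections

variable {m : ℕ} {M : Type*} [TopologicalSpace M]
  [ChartedSpace (EuclideanSpace ℝ (Fin m)) M] [IsManifold (𝓡 m) ∞ M]

/-- The smooth 1-form `i_X Ω`. -/
def TwoForm.contract (Ω : TwoForm m M) (X : VectorField m M) : OneForm m M where
  toFun x := Ω.flat x (X x)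
  contMDiff_toFun := Ω.flat.contMDiff.clm_bundle_apply X.contMDiff

/-- The smooth vector field `α♯`. -/
def Bivector.sharpField (Λ : Bivector m M) (α : OneForm m M) : VectorField m M where
  toFun x := Λ.sharp x (α x)
  contMDiff_toFun := Λ.sharp.contMDiff.clm_bundle_apply α.contMDiff

/-- The smooth function `α(X)`. -/
def pairing (α : OneForm m M) (X : VectorField m M) : SmoothFun m M where
  val x := α x (X x)
  property x := by
    have h := (α.contMDiff.clm_bundle_apply X.contMDiff) x
    rw [Bundle.contMDiffAt_section] at h
    exact h

/-- The product of a smooth vector field by a smooth function. -/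
def smulField (f : SmoothFun m M) (X : VectorField m M) : VectorField m M where
  toFun x := f x • X x
  contMDiff_toFun := ContMDiff.smul_section f.contMDiff X.contMDiff

/-- The product of a smooth 1-form by a smooth function. -/
def smulForm (f : SmoothFun m M) (α : OneForm m M) : OneForm m M where
  toFun x := f x • α x
  contMDiff_toFun := ContMDiff.smul_section f.contMDiff α.contMDiff

/-- The Lie bracket of two smooth vector fields, as a smooth vector field. -/
def lieBracketField (X Y : VectorField m M) : VectorField m M where
  toFun := mlieBracket (𝓡 m) X Y
  contMDiff_toFun := by
    have : IsManifold (𝓡 m) (((⊤ : ℕ∞) : WithTop ℕ∞) + 1) M := by simpa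
    have : IsManifold (𝓡 m) (minSmoothness ℝ 2) M := .of_le (n := ∞) (by simpa using ENat.LEInfty.out)
    exact ContDiff.mlieBracket_vectorField (m := ⊤) (n := ⊤) X.contMDiff Y.contMDiff (by simp)

/-- The derivative `X.f` of a smooth function along a smooth vector field. -/
def derivAlong (X : VectorField m M) (f : SmoothFun m M) : SmoothFun m M where
  val x := dFun f x (X x)
  property := by
    have h : ContMDiff (𝓡 m).tangent 𝓘(ℝ, ℝ).tangent ∞ (tangentMap (𝓡 m) 𝓘(ℝ, ℝ) f) :=
      f.contMDiff.contMDiff_tangentMap (by simp)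
    exact (contMDiff_snd_tangentBundle_modelSpace ℝ 𝓘(ℝ, ℝ)).comp (h.comp X.contMDiff)

@[simp] lemma pairing_apply (α : OneForm m M) (X : VectorField m M) (x : M) :
    pairing α X x = α x (X x) := rfl

@[simp] lemma smulField_apply (f : SmoothFun m M) (X : VectorField m M) (x : M) :
    smulField f X x = f x • X x := rfl

end Sections

/-! ### Coordinate expressions in the preferred chart and their differentiability. -/

section Coordinates

variable {m : ℕ} {M : Type*} [TopologicalSpace M]
  [ChartedSpace (EuclideanSpace ℝ (Fin m)) M] [IsManifold (𝓡 m) ∞ M]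

variable (m) in
/-- The derivative at `y` of the inverse of the preferred chart at `x`. -/
def chartFrame (x : M) (y : EuclideanSpace ℝ (Fin m)) :
    EuclideanSpace ℝ (Fin m) →L[ℝ] EuclideanSpace ℝ (Fin m) :=
  mfderiv 𝓘(ℝ, EuclideanSpace ℝ (Fin m)) (𝓡 m) (extChartAt (𝓡 m) x).symm y

/-- A function in the preferred chart at `x`. -/
def coordFun (x : M) (f : M → ℝ) (y : EuclideanSpace ℝ (Fin m)) : ℝ :=
  f ((extChartAt (𝓡 m) x).symm y)

/-- A vector field in the preferred chart at `x`. -/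
def coordField (x : M) (X : VectorField m M) (y : EuclideanSpace ℝ (Fin m)) :
    EuclideanSpace ℝ (Fin m) :=
  (chartFrame m x y).inverse (X ((extChartAt (𝓡 m) x).symm y))

/-- A 1-form in the preferred chart at `x`. -/
def coordForm (x : M) (α : OneForm m M) (y : EuclideanSpace ℝ (Fin m)) :
    EuclideanSpace ℝ (Fin m) →L[ℝ] ℝ :=
  ContinuousLinearMap.comp (α ((extChartAt (𝓡 m) x).symm y)) (chartFrame m x y)

/-- A 2-form in the preferred chart at `x`. -/
def coordTwoForm (x : M) (Ω : TwoForm m M) (y : EuclideanSpace ℝ (Fin m)) :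
    EuclideanSpace ℝ (Fin m) →L[ℝ] EuclideanSpace ℝ (Fin m) →L[ℝ] ℝ :=
  ContinuousLinearMap.bilinearComp (E := EuclideanSpace ℝ (Fin m))
    (F := EuclideanSpace ℝ (Fin m))
    (Ω.flat ((extChartAt (𝓡 m) x).symm y)) (chartFrame m x y) (chartFrame m x y)

/-- The tangent space at `x` is identified with the model space through this very chart.
Consequently coordinate expressions take the intrinsic values at the base point, and first-order
operators there become ordinary Fréchet derivatives. -/
lemma chartFrame_self (x : M) : chartFrame m x (extChartAt (𝓡 m) x x) = .id ℝ _ := by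
  have : IsManifold (𝓡 m) 1 M := .of_le (n := ∞) (by simp)
  have h := mfderivWithin_range_extChartAt_symm (I := 𝓡 m) (x := x)
  rw [ModelWithCorners.range_eq_univ, mfderivWithin_univ] at h
  exact h

lemma eventually_isInvertible_chartFrame (x : M) :
    ∀ᶠ y in nhds (extChartAt (𝓡 m) x x), (chartFrame m x y).IsInvertible := by
  have : IsManifold (𝓡 m) 1 M := .of_le (n := ∞) (by simp)
  filter_upwards [extChartAt_target_mem_nhds (I := 𝓡 m) x] with y hy
  have h := isInvertible_mfderivWithin_extChartAt_symm hy
  rw [ModelWithCorners.range_eq_univ, mfderivWithin_univ] at h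
  exact h

lemma eventually_chartFrame_coordField (x : M) (X : VectorField m M) :
    ∀ᶠ y in nhds (extChartAt (𝓡 m) x x),
      chartFrame m x y (coordField x X y) = X ((extChartAt (𝓡 m) x).symm y) := by
  filter_upwards [eventually_isInvertible_chartFrame x] with y hy
  exact hy.self_apply_inverse _

@[simp] lemma coordField_self (x : M) (X : VectorField m M) :
    coordField x X (extChartAt (𝓡 m) x x) = X x := by
  rw [coordField, chartFrame_self]
  erw [ContinuousLinearMap.inverse_id]
  rw [extChartAt_to_inv (I := 𝓡 m) x]; rfl

@[simp] lemma coordForm_self (x : M) (α : OneForm m M) :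
    coordForm x α (extChartAt (𝓡 m) x x) = α x := by
  simp only [coordForm, chartFrame_self]
  rw [extChartAt_to_inv (I := 𝓡 m) x]; rfl

@[simp] lemma coordTwoForm_self (x : M) (Ω : TwoForm m M) :
    coordTwoForm x Ω (extChartAt (𝓡 m) x x) = Ω.flat x := by
  simp only [coordTwoForm, chartFrame_self]
  rw [extChartAt_to_inv (I := 𝓡 m) x]; rfl

lemma differentiableAt_coordField (x : M) (X : VectorField m M) :
    DifferentiableAt ℝ (coordField x X) (extChartAt (𝓡 m) x x) := by
  have : IsManifold (𝓡 m) 2 M := .of_le (n := ∞) ENat.LEInfty.out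
  have h := MDifferentiableWithinAt.differentiableWithinAt_mpullbackWithin_vectorField
    (X.contMDiff.mdifferentiable (n := ∞) (by simp) x).mdifferentiableWithinAt (s := Set.univ)
  simp only [ModelWithCorners.range_eq_univ, mpullbackWithin_univ, Set.preimage_univ,
    Set.inter_univ] at h
  exact differentiableWithinAt_univ.1 h

omit [IsManifold (𝓡 m) ∞ M] in
lemma differentiableAt_coordFun (x : M) {f : M → ℝ} (hf : MDifferentiableAt (𝓡 m) 𝓘(ℝ, ℝ) f x) :
    DifferentiableAt ℝ (coordFun (m := m) x f) (extChartAt (𝓡 m) x x) := by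
  have h := hf.mdifferentiableWithinAt (s := Set.univ)
    |>.differentiableWithinAt_comp_extChartAt_symm
  simp only [ModelWithCorners.range_eq_univ, Set.preimage_univ, Set.inter_univ,
    differentiableWithinAt_univ] at h
  exact h

omit [IsManifold (𝓡 m) ∞ M] in
lemma dFun_eq_fderiv (x : M) {f : M → ℝ} (hf : MDifferentiableAt (𝓡 m) 𝓘(ℝ, ℝ) f x) :
    dFun f x = fderiv ℝ (coordFun (m := m) x f) (extChartAt (𝓡 m) x x) := by
  simp only [dFun, mfderiv, hf, ModelWithCorners.range_eq_univ, fderivWithin_univ]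
  rfl

lemma mlieBracket_eq_lieBracket (x : M) (X Y : VectorField m M) :
    mlieBracket (𝓡 m) X Y x =
      lieBracket ℝ (coordField x X) (coordField x Y) (extChartAt (𝓡 m) x x) := by
  have : IsManifold (𝓡 m) 1 M := .of_le (n := ∞) (by simp)
  rw [← mlieBracketWithin_univ, mlieBracketWithin_apply, mfderiv_extChartAt_self]
  simp only [ModelWithCorners.range_eq_univ, mpullbackWithin_univ, Set.preimage_univ,
    Set.inter_univ]
  erw [ContinuousLinearMap.inverse_id, lieBracketWithin_univ]
  rfl

lemma dOne_apply (x : M) (α : OneForm m M) (u v : EuclideanSpace ℝ (Fin m)) :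
    (dOne α x : EuclideanSpace ℝ (Fin m) →L[ℝ] EuclideanSpace ℝ (Fin m) →L[ℝ] ℝ) u v =
      fderiv ℝ (coordForm x α) (extChartAt (𝓡 m) x x) u v
      - fderiv ℝ (coordForm x α) (extChartAt (𝓡 m) x x) v u := by
  have : IsManifold (𝓡 m) 1 M := .of_le (n := ∞) (by simp)
  rw [dOne, mfderiv_extChartAt_self]
  rfl

lemma dTwo_apply (x : M) (Ω : TwoForm m M) (u v w : EuclideanSpace ℝ (Fin m)) :
    dTwo Ω x u v w =
      fderiv ℝ (fun y => coordTwoForm x Ω y v w) (extChartAt (𝓡 m) x x) u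
      - fderiv ℝ (fun y => coordTwoForm x Ω y u w) (extChartAt (𝓡 m) x x) v
      + fderiv ℝ (fun y => coordTwoForm x Ω y u v) (extChartAt (𝓡 m) x x) w := by
  have : IsManifold (𝓡 m) 1 M := .of_le (n := ∞) (by simp)
  change (fun L : EuclideanSpace ℝ (Fin m) →L[ℝ] EuclideanSpace ℝ (Fin m) =>
    fderiv ℝ (fun y => coordTwoForm x Ω y (L v) (L w)) (extChartAt (𝓡 m) x x) (L u)
      - fderiv ℝ (fun y => coordTwoForm x Ω y (L u) (L w)) (extChartAt (𝓡 m) x x) (L v)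
      + fderiv ℝ (fun y => coordTwoForm x Ω y (L u) (L v)) (extChartAt (𝓡 m) x x) (L w))
    (mfderiv (𝓡 m) 𝓘(ℝ, EuclideanSpace ℝ (Fin m)) (extChartAt (𝓡 m) x) x) = _
  rw [mfderiv_extChartAt_self]
  rfl

/-- The vector field around `x` which is constant, equal to `v`, in the preferred chart at `x`. -/
def chartConst (x : M) (v : EuclideanSpace ℝ (Fin m)) (z : M) : TangentSpace (𝓡 m) z :=
  chartFrame m x (extChartAt (𝓡 m) x z) v

/-- In the trivialization of the tangent bundle at `x` this field is the constant `v`. Evaluating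
forms on such fields yields their coordinate components. -/
lemma contMDiffAt_chartConst (x : M) (v : EuclideanSpace ℝ (Fin m)) :
    ContMDiffAt (𝓡 m) (𝓡 m).tangent ∞
      (fun z => Bundle.TotalSpace.mk' (EuclideanSpace ℝ (Fin m)) z (chartConst x v z)) x := by
  have : IsManifold (𝓡 m) 1 M := .of_le (n := ∞) (by simp)
  rw [Bundle.contMDiffAt_section]
  refine (contMDiffAt_const (c := v)).congr_of_eventuallyEq ?_
  filter_upwards [chart_source_mem_nhds (EuclideanSpace ℝ (Fin m)) x] with z hz
  have h1 := congrArg (fun L => L v) (TangentBundle.symmL_trivializationAt (I := 𝓡 m) hz)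
  rw [ModelWithCorners.range_eq_univ, mfderivWithin_univ] at h1
  have hz' : z ∈ (trivializationAt (EuclideanSpace ℝ (Fin m))
      (TangentSpace (𝓡 m) (M := M)) x).baseSet := hz
  have h2 := (trivializationAt (EuclideanSpace ℝ (Fin m)) (TangentSpace (𝓡 m)) x)
    |>.continuousLinearMapAt_symmL (R := ℝ) hz' v
  erw [h1] at h2
  refine Eq.trans ?_ h2
  exact (congrFun (Bundle.Trivialization.coe_linearMapAt_of_mem (R := ℝ)
      (trivializationAt (EuclideanSpace ℝ (Fin m)) (TangentSpace (𝓡 m)) x) hz')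
      (chartConst x v z)).symm

/-- With `F` finite dimensional, an operator on `F` is the same as the tuple of its values on a
basis, so componentwise differentiability suffices. -/
lemma differentiableAt_clm_of_apply {D F G : Type*} [NormedAddCommGroup D] [NormedSpace ℝ D]
    [NormedAddCommGroup F] [NormedSpace ℝ F] [FiniteDimensional ℝ F] [NormedAddCommGroup G]
    [NormedSpace ℝ G] {f : D → F →L[ℝ] G} {x : D}
    (h : ∀ v, DifferentiableAt ℝ (fun y => f y v) x) : DifferentiableAt ℝ f x := by
  let d := Module.finrank ℝ F
  have hd : d = Module.finrank ℝ (Fin d → ℝ) := (Module.finrank_fin_fun ℝ).symm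
  let e₁ := ContinuousLinearEquiv.ofFinrankEq hd
  let e₂ := (e₁.arrowCongr (1 : G ≃L[ℝ] G)).trans (ContinuousLinearEquiv.piRing (Fin d))
  rw [← e₂.comp_differentiableAt_iff, differentiableAt_pi]
  exact fun i => h _

lemma differentiableAt_coordForm (x : M) (α : OneForm m M) :
    DifferentiableAt ℝ (coordForm x α) (extChartAt (𝓡 m) x x) := by
  refine differentiableAt_clm_of_apply fun v => ?_
  have h := α.contMDiff.contMDiffAt.clm_bundle_apply (contMDiffAt_chartConst x v)
  rw [Bundle.contMDiffAt_section] at h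
  refine (differentiableAt_coordFun x (h.mdifferentiableAt (by simp))).congr_of_eventuallyEq ?_
  filter_upwards [extChartAt_target_mem_nhds (I := 𝓡 m) x] with y hy
  simp only [coordForm, coordFun, chartConst]
  erw [(extChartAt (𝓡 m) x).right_inv hy]
  rfl

lemma differentiableAt_coordTwoForm (x : M) (Ω : TwoForm m M) :
    DifferentiableAt ℝ (coordTwoForm x Ω) (extChartAt (𝓡 m) x x) := by
  refine differentiableAt_clm_of_apply fun v => differentiableAt_clm_of_apply fun w => ?_
  have h := (Ω.flat.contMDiff.contMDiffAt.clm_bundle_apply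
    (contMDiffAt_chartConst x v)).clm_bundle_apply (contMDiffAt_chartConst x w)
  rw [Bundle.contMDiffAt_section] at h
  refine (differentiableAt_coordFun x (h.mdifferentiableAt (by simp))).congr_of_eventuallyEq ?_
  filter_upwards [extChartAt_target_mem_nhds (I := 𝓡 m) x] with y hy
  simp only [coordTwoForm, coordFun, chartConst]
  erw [(extChartAt (𝓡 m) x).right_inv hy]
  rfl

end Coordinates

/-! ### Cartan formulas for 1-forms and closed 2-forms. -/

section Cartan

variable {m : ℕ} {M : Type*} [TopologicalSpace M]
  [ChartedSpace (EuclideanSpace ℝ (Fin m)) M] [IsManifold (𝓡 m) ∞ M]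

lemma coordFun_pairing (x : M) (α : OneForm m M) (X : VectorField m M) :
    coordFun x (pairing α X) =ᶠ[nhds (extChartAt (𝓡 m) x x)]
      fun y => coordForm x α y (coordField x X y) := by
  filter_upwards [eventually_chartFrame_coordField x X] with y hy
  exact (congrArg (α ((extChartAt (𝓡 m) x).symm y)) hy).symm

lemma coordForm_contract (x : M) (Ω : TwoForm m M) (X : VectorField m M) :
    coordForm x (Ω.contract X) =ᶠ[nhds (extChartAt (𝓡 m) x x)]
      fun y => coordTwoForm x Ω y (coordField x X y) := by
  filter_upwards [eventually_chartFrame_coordField x X] with y hy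
  ext w
  exact (congrArg (fun v => Ω.flat ((extChartAt (𝓡 m) x).symm y) v (chartFrame m x y w)) hy).symm

lemma dFun_pairing (x : M) (α : OneForm m M) (X : VectorField m M)
    (u : EuclideanSpace ℝ (Fin m)) :
    (dFun (pairing α X) x : EuclideanSpace ℝ (Fin m) →L[ℝ] ℝ) u =
      fderiv ℝ (coordForm x α) (extChartAt (𝓡 m) x x) u (X x)
      + α x (fderiv ℝ (coordField x X) (extChartAt (𝓡 m) x x) u) := by
  rw [dFun_eq_fderiv x ((pairing α X).mdifferentiableAt), (coordFun_pairing x α X).fderiv_eq,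
    fderiv_clm_apply (differentiableAt_coordForm x α) (differentiableAt_coordField x X)]
  rw [coordField_self, coordForm_self]
  exact add_comm _ _

/-- Cartan's formula for the exterior derivative of a 1-form. -/
lemma apply_mlieBracket (x : M) (α : OneForm m M) (X Y : VectorField m M) :
    α x (mlieBracket (𝓡 m) X Y x) =
      dFun (pairing α Y) x (X x) - dFun (pairing α X) x (Y x) - dOne α x (X x) (Y x) := by
  have h1 := dFun_pairing x α Y (X x)
  have h2 := dFun_pairing x α X (Y x)
  have h3 := dOne_apply x α (X x) (Y x)
  -- In the chart `[X, Y] = D_X Y - D_Y X`; the derivatives of the coefficients of `α` in the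
  -- product rule antisymmetrize to `dα(X, Y)`.
  have h4 : α x (mlieBracket (𝓡 m) X Y x) =
      α x (fderiv ℝ (coordField x Y) (extChartAt (𝓡 m) x x) (X x))
      - α x (fderiv ℝ (coordField x X) (extChartAt (𝓡 m) x x) (Y x)) := by
    rw [mlieBracket_eq_lieBracket, lieBracket_eq]
    simp only [coordField_self]
    exact map_sub (α x) _ _
  rw [h4]
  erw [h1, h2, h3]
  ring

lemma TwoForm.skew (Ω : TwoForm m M) (x : M) (u v : TangentSpace (𝓡 m) x) :
    Ω.flat x u v = - Ω.flat x v u := by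
  have h := Ω.alternating x (u + v)
  simp only [map_add, add_apply, Ω.alternating x] at h
  linarith

/-- Cartan's formula `i_{[X, Y]} Ω = i_X d(i_Y Ω) - i_Y d(i_X Ω) + d(Ω(Y, X))` for a closed
2-form. -/
lemma TwoForm.contract_mlieBracket (Ω : TwoForm m M) {x : M} (hΩ : ∀ u v w, dTwo Ω x u v w = 0)
    (X Y : VectorField m M) :
    Ω.flat x (mlieBracket (𝓡 m) X Y x) =
      dOne (Ω.contract Y) x (X x) - dOne (Ω.contract X) x (Y x)
      + dFun (pairing (Ω.contract Y) X) x := by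
  have hb := differentiableAt_coordTwoForm x Ω
  have hd : ∀ (Z : VectorField m M) (u w : EuclideanSpace ℝ (Fin m)),
      fderiv ℝ (coordForm x (Ω.contract Z)) (extChartAt (𝓡 m) x x) u w =
        fderiv ℝ (coordTwoForm x Ω) (extChartAt (𝓡 m) x x) u (Z x) w +
        Ω.flat x (fderiv ℝ (coordField x Z) (extChartAt (𝓡 m) x x) u) w := by
    intro Z u w
    rw [(coordForm_contract x Ω Z).fderiv_eq,
      fderiv_clm_apply hb (differentiableAt_coordField x Z), coordField_self, coordTwoForm_self]
    exact add_comm _ _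
  have hT : ∀ u v w : EuclideanSpace ℝ (Fin m),
      fderiv ℝ (fun y => coordTwoForm x Ω y v w) (extChartAt (𝓡 m) x x) u =
        fderiv ℝ (coordTwoForm x Ω) (extChartAt (𝓡 m) x x) u v w := by
    intro u v w
    rw [fderiv_clm_apply (by fun_prop) (by fun_prop), fderiv_clm_apply (by fun_prop) (by fun_prop)]
    simp
  have hdΩ : ∀ u v w : EuclideanSpace ℝ (Fin m), dTwo Ω x u v w =
      fderiv ℝ (coordTwoForm x Ω) (extChartAt (𝓡 m) x x) u v w
      - fderiv ℝ (coordTwoForm x Ω) (extChartAt (𝓡 m) x x) v u w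
      + fderiv ℝ (coordTwoForm x Ω) (extChartAt (𝓡 m) x x) w u v := by
    intro u v w
    rw [dTwo_apply, hT, hT, hT]
  refine ContinuousLinearMap.ext fun w => ?_
  have h0 := hΩ (X x) (Y x) w
  have h1 := dOne_apply x (Ω.contract Y) (X x) w
  have h2 := dOne_apply x (Ω.contract X) (Y x) w
  have h3 := dFun_pairing x (Ω.contract Y) X w
  have h4 : Ω.flat x (mlieBracket (𝓡 m) X Y x) w =
      Ω.flat x (fderiv ℝ (coordField x Y) (extChartAt (𝓡 m) x x) (X x)) w
      - Ω.flat x (fderiv ℝ (coordField x X) (extChartAt (𝓡 m) x x) (Y x)) w := by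
    rw [mlieBracket_eq_lieBracket, lieBracket_eq]
    simp only [coordField_self]
    exact congrArg (fun L => L w) (map_sub (Ω.flat x) _ _)
  have h5 := Ω.skew x (Y x) (fderiv ℝ (coordField x X) (extChartAt (𝓡 m) x x) w)
  -- The derivatives `b₁`, `b₂`, `b₃` of the coefficients of `Ω` cancel by closedness, and the terms
  -- `z`, `t` containing `D_w X` cancel by skew-symmetry. What is left is `k - l = Ω(D_X Y - D_Y X,
  -- w)`.
  have key : ∀ {o a b c p q r s t k l z b₁ b₂ b₃ : ℝ}, b₁ - b₂ + b₃ = 0 → a = p - q →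
      b = r - s → c = q + t → o = k - l → p = b₁ + k → r = b₂ + l →
      s = b₃ + z → t = -z → o = a - b + c := by
    intros; linarith
  exact key ((hdΩ (X x) (Y x) w).symm.trans h0) h1 h2 h3 h4 (hd Y (X x) w) (hd X (Y x) w) (hd X w (Y x)) h5

lemma coordForm_sub_smulForm (x : M) (α β : OneForm m M) (f : SmoothFun m M) :
    coordForm x (α - smulForm f β) =
      fun y => coordForm x α y - coordFun x f y • coordForm x β y := rfl

/-- Needed because contracting `Ω` with a generated field gives exactly a form of the shape `α - f
ω`. -/
lemma dOne_sub_smulForm (x : M) (α β : OneForm m M) (f : SmoothFun m M)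
    (u v : TangentSpace (𝓡 m) x) :
    dOne (α - smulForm f β) x u v = dOne α x u v
      - (dFun f x u * β x v - dFun f x v * β x u + f x * dOne β x u v) := by
  have hα := differentiableAt_coordForm x α
  have hβ := differentiableAt_coordForm x β
  have hf := differentiableAt_coordFun x (f.mdifferentiableAt)
  have hd : ∀ u v : EuclideanSpace ℝ (Fin m),
      fderiv ℝ (coordForm x (α - smulForm f β)) (extChartAt (𝓡 m) x x) u v =
        fderiv ℝ (coordForm x α) (extChartAt (𝓡 m) x x) u v
        - (f x * fderiv ℝ (coordForm x β) (extChartAt (𝓡 m) x x) u v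
          + fderiv ℝ (coordFun x f) (extChartAt (𝓡 m) x x) u * β x v) := by
    intro u v
    rw [coordForm_sub_smulForm, fderiv_fun_sub hα (by fun_prop), fderiv_fun_smul hf hβ,
      coordForm_self, coordFun, extChartAt_to_inv]
    rfl
  have key : ∀ {o a b p q r s c d k l g : ℝ}, o = p - q → p = r - (g * c + k) →
      q = s - (g * d + l) → a = r - s → b = c - d → o = a - (k - l + g * b) := by
    rintro _ _ _ _ _ _ _ _ _ _ _ _ rfl rfl rfl rfl rfl; ring
  rw [dFun_eq_fderiv x (f.mdifferentiableAt)]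
  exact key (dOne_apply x (α - smulForm f β) u v) (hd u v) (hd v u) (dOne_apply x α u v)
    (dOne_apply x β u v)

end Cartan

/-! ### Nondegeneracy from a nonzero top-degree form. -/

section LinearAlgebra

variable {V : Type*} [AddCommGroup V] [Module ℝ V] {n : ℕ}

/-- The multilinear form `a ⊗ B ⊗ ⋯ ⊗ B`, with `n` factors `B`. -/
def tensorPower (n : ℕ) (a : V →ₗ[ℝ] ℝ) (B : V →ₗ[ℝ] V →ₗ[ℝ] ℝ) :
    MultilinearMap ℝ (fun _ : Fin (2 * n + 1) => V) ℝ :=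
  -- Each slot occurs in exactly one factor: slot `0` in `a`, slot `j > 0` in the factor `B` with
  -- index `(j - 1) / 2`. With the other slots frozen, the product is linear in that one.
  have key : ∀ (v : Fin (2 * n + 1) → V) (j : Fin (2 * n + 1)), ∃ L : V →ₗ[ℝ] ℝ, ∀ u,
      a (Function.update v j u ⟨0, by omega⟩) * ∏ i : Fin n,
        B (Function.update v j u ⟨2 * i.1 + 1, by omega⟩)
          (Function.update v j u ⟨2 * i.1 + 2, by omega⟩) = L u := by
    intro v j
    by_cases hj : j.1 = 0
    · refine ⟨(∏ i : Fin n, B (v ⟨2 * i.1 + 1, by omega⟩) (v ⟨2 * i.1 + 2, by omega⟩)) • a,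
        fun u => ?_⟩
      simp [Function.update_apply, Fin.ext_iff, hj, mul_comm]
    · obtain ⟨k, hk⟩ : ∃ k : Fin n, j.1 = 2 * k.1 + 1 ∨ j.1 = 2 * k.1 + 2 :=
        ⟨⟨(j.1 - 1) / 2, by omega⟩, by dsimp only; omega⟩
      have hrest : ∀ u, ∏ i ∈ Finset.univ.erase k,
          B (Function.update v j u ⟨2 * i.1 + 1, by omega⟩)
            (Function.update v j u ⟨2 * i.1 + 2, by omega⟩) =
          ∏ i ∈ Finset.univ.erase k, B (v ⟨2 * i.1 + 1, by omega⟩) (v ⟨2 * i.1 + 2, by omega⟩) := by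
        intro u
        refine Finset.prod_congr rfl fun i hi => ?_
        have hik : i.1 ≠ k.1 := fun h => (Finset.ne_of_mem_erase hi) (Fin.ext h)
        rw [Function.update_of_ne, Function.update_of_ne] <;>
          · rw [Ne, Fin.ext_iff]; dsimp only; omega
      have h0 : ∀ u, Function.update v j u ⟨0, by omega⟩ = v ⟨0, by omega⟩ := fun u =>
        Function.update_of_ne (by rw [Ne, Fin.ext_iff]; dsimp only; omega) _ _
      simp only [← Finset.mul_prod_erase Finset.univ _ (Finset.mem_univ k), hrest, h0]
      rcases hk with hk | hk
      · refine ⟨(a (v ⟨0, by omega⟩) * ∏ i ∈ Finset.univ.erase k,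
          B (v ⟨2 * i.1 + 1, by omega⟩) (v ⟨2 * i.1 + 2, by omega⟩)) •
          B.flip (v ⟨2 * k.1 + 2, by omega⟩), fun u => ?_⟩
        simp [Function.update_apply, Fin.ext_iff, hk]
        ring
      · refine ⟨(a (v ⟨0, by omega⟩) * ∏ i ∈ Finset.univ.erase k,
          B (v ⟨2 * i.1 + 1, by omega⟩) (v ⟨2 * i.1 + 2, by omega⟩)) •
          B (v ⟨2 * k.1 + 1, by omega⟩), fun u => ?_⟩
        simp [Function.update_apply, Fin.ext_iff, hk]
        ring
  { toFun := fun v => a (v ⟨0, by omega⟩) *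
      ∏ i : Fin n, B (v ⟨2 * i.1 + 1, by omega⟩) (v ⟨2 * i.1 + 2, by omega⟩)
    map_update_add' := by
      intro inst v j u w
      -- The multilinearity axioms quantify over all decidability instances, while `key` is stated
      -- for the canonical one.
      obtain rfl : inst = instDecidableEqFin _ := Subsingleton.elim _ _
      obtain ⟨L, hL⟩ := key v j
      simp only [hL, map_add]
    map_update_smul' := by
      intro inst v j c u
      obtain rfl : inst = instDecidableEqFin _ := Subsingleton.elim _ _
      obtain ⟨L, hL⟩ := key v j
      simp only [hL, map_smul] }

lemma tensorPower_eq_zero {a : V →ₗ[ℝ] ℝ} {B : V →ₗ[ℝ] V →ₗ[ℝ] ℝ} (hB : ∀ u, B u u = 0)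
    {w : V} (ha : a w = 0) (hw : B w = 0) {v : Fin (2 * n + 1) → V} {j : Fin (2 * n + 1)}
    (hj : v j = w) : tensorPower n a B v = 0 := by
  have hw' : ∀ u, B u w = 0 := by
    intro u
    have h := hB (u + w)
    simpa [hB, hw] using h
  change a (v ⟨0, by omega⟩) *
      ∏ i : Fin n, B (v ⟨2 * i.1 + 1, by omega⟩) (v ⟨2 * i.1 + 2, by omega⟩) = 0
  by_cases h0 : j.1 = 0
  · have : (⟨0, by omega⟩ : Fin (2 * n + 1)) = j := Fin.ext h0.symm
    rw [this, hj, ha, zero_mul]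
  · refine mul_eq_zero_of_right _ (Finset.prod_eq_zero
      (Finset.mem_univ (⟨(j.1 - 1) / 2, by omega⟩ : Fin n)) ?_)
    obtain h | h : j.1 = 2 * ((j.1 - 1) / 2) + 1 ∨ j.1 = 2 * ((j.1 - 1) / 2) + 2 := by omega
    · have : (⟨2 * ((j.1 - 1) / 2) + 1, by omega⟩ : Fin (2 * n + 1)) = j := Fin.ext h.symm
      simp [this, hj, hw]
    · have : (⟨2 * ((j.1 - 1) / 2) + 2, by omega⟩ : Fin (2 * n + 1)) = j := Fin.ext h.symm
      simp [this, hj, hw']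

/-- If `a ∧ B ∧ ⋯ ∧ B` is a nonzero form of top degree, then `a` and `B` have no common kernel. -/
lemma eq_zero_of_alternatization_tensorPower_ne_zero {a : V →ₗ[ℝ] ℝ} {B : V →ₗ[ℝ] V →ₗ[ℝ] ℝ}
    (hV : Module.finrank ℝ V = 2 * n + 1) (hB : ∀ u, B u u = 0)
    {v : Fin (2 * n + 1) → V} (hv : MultilinearMap.alternatization (tensorPower n a B) v ≠ 0)
    {w : V} (ha : a w = 0) (hw : B w = 0) : w = 0 := by
  set A := MultilinearMap.alternatization (tensorPower n a B) with hA
  have hli : LinearIndependent ℝ v := by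
    by_contra h
    exact hv (A.map_linearDependent v h)
  let b := basisOfLinearIndependentOfCardEqFinrank hli (by simp [hV])
  have hb : ∀ i, b i = v i := fun i => by simp [b]
  -- In the summand of `σ` the vector `w` sits in slot `σ⁻¹ j`, and a common kernel vector in any
  -- slot kills the product.
  have hupd : ∀ j, A (Function.update v j w) = 0 := by
    intro j
    rw [hA, MultilinearMap.alternatization_apply]
    refine Finset.sum_eq_zero fun σ _ => ?_
    rw [MultilinearMap.domDomCongr_apply, tensorPower_eq_zero hB ha hw (j := σ⁻¹ j), smul_zero]
    simp
  -- Expanding `w` in the basis `v`, only the `j`-th term survives alternation, so the vanishing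
  -- value is the `j`-th coordinate of `w` times `A v`.
  have hrepr : ∀ j, b.repr w j = 0 := by
    intro j
    have h := hupd j
    rw [← b.sum_repr w, A.map_update_sum, Finset.sum_eq_single j] at h
    · rw [A.map_update_smul, hb, Function.update_eq_self, smul_eq_mul] at h
      exact (mul_eq_zero.1 h).resolve_right hv
    · intro i _ hij
      rw [A.map_update_smul, hb, A.map_update_self _ (Ne.symm hij), smul_zero]
    · simp
  exact b.repr.map_eq_zero_iff.1 (Finsupp.ext hrepr)

end LinearAlgebra

/-! ### Joint injectivity of `ω` and `Ω♭`. -/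

section Structure

variable {n : ℕ} {M : Type*} [TopologicalSpace M]
  [ChartedSpace (EuclideanSpace ℝ (Fin (2 * n + 1))) M] [IsManifold (𝓡 (2 * n + 1)) ∞ M]
  {ω₀ : OneForm (2 * n + 1) M} {Ω : TwoForm (2 * n + 1) M}
  {E : VectorField (2 * n + 1) M} {Λ : Bivector (2 * n + 1) M}

/-- The sum over permutations in `volForm` is the alternatization of `tensorPower`, so the linear
algebra above applies with `a = ω` and `B = Ω`. -/
lemma IsAlmostCosymplecticContact.eq_zero (h : IsAlmostCosymplecticContact ω₀ Ω) {x : M}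
    {w : TangentSpace (𝓡 (2 * n + 1)) x} (hω : ω₀ x w = 0) (hΩ : Ω.flat x w = 0) : w = 0 := by
  obtain ⟨v, hv⟩ := h.regular x
  refine eq_zero_of_alternatization_tensorPower_ne_zero
    (V := TangentSpace (𝓡 (2 * n + 1)) x) (a := (ω₀ x).toLinearMap)
    (B := (ContinuousLinearMap.coeLM ℝ).comp (Ω.flat x).toLinearMap) (v := v) ?_
    (Ω.alternating x) ?_ hω ?_
  · exact finrank_euclideanSpace_fin
  · refine fun h0 => hv ?_
    rw [MultilinearMap.alternatization_apply] at h0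
    refine Eq.trans (Finset.sum_congr rfl fun σ _ => ?_) h0
    rw [Units.smul_def, zsmul_eq_mul]
    rfl
  · ext u
    exact congrArg (fun L => L u) hΩ

end Structure

/-! ### Vector fields as a Lie algebra acting on functions. -/

section LieAlgebra

variable {m : ℕ} {M : Type*} [TopologicalSpace M]
  [ChartedSpace (EuclideanSpace ℝ (Fin m)) M] [IsManifold (𝓡 m) ∞ M]

omit [IsManifold (𝓡 m) ∞ M] in
lemma dFun_add (f g : SmoothFun m M) (x : M) :
    dFun (f + g : SmoothFun m M) x = (dFun f x + dFun g x : TangentSpace (𝓡 m) x →L[ℝ] ℝ) :=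
  mvfderiv_add (f.mdifferentiableAt) (g.mdifferentiableAt)

omit [IsManifold (𝓡 m) ∞ M] in
lemma dFun_const_smul (c : ℝ) (f : SmoothFun m M) (x : M) :
    dFun (c • f : SmoothFun m M) x = (c • dFun f x : TangentSpace (𝓡 m) x →L[ℝ] ℝ) :=
  const_smul_mfderiv (f.mdifferentiableAt) c

lemma derivAlong_add_right (X : VectorField m M) (f g : SmoothFun m M) :
    derivAlong X (f + g) = derivAlong X f + derivAlong X g := by
  ext x
  exact congrArg (fun L => L (X x)) (dFun_add f g x)

lemma derivAlong_add_left (X Y : VectorField m M) (f : SmoothFun m M) :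
    derivAlong (X + Y) f = derivAlong X f + derivAlong Y f := by
  ext x
  exact map_add (dFun f x) (X x) (Y x)

lemma derivAlong_smul_right (X : VectorField m M) (c : ℝ) (f : SmoothFun m M) :
    derivAlong X (c • f) = c • derivAlong X f := by
  ext x
  exact congrArg (fun L => L (X x)) (dFun_const_smul c f x)

lemma derivAlong_smul_left (c : ℝ) (X : VectorField m M) (f : SmoothFun m M) :
    derivAlong (c • X) f = c • derivAlong X f := by
  ext x
  exact map_smul (dFun f x) c (X x)

lemma mdifferentiableAt_vectorField (X : VectorField m M) (x : M) :
    MDifferentiableAt (𝓡 m) (𝓡 m).tangent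
      (fun y => (⟨y, X y⟩ : TangentBundle (𝓡 m) M)) x :=
  X.contMDiff.mdifferentiable (n := ∞) (by simp) x

lemma lieBracketField_add_left (X Y Z : VectorField m M) :
    lieBracketField (X + Y) Z = lieBracketField X Z + lieBracketField Y Z := by
  have : IsManifold (𝓡 m) 2 M := .of_le (n := ∞) ENat.LEInfty.out
  ext x
  exact mlieBracket_add_left (mdifferentiableAt_vectorField X x)
    (mdifferentiableAt_vectorField Y x)

lemma lieBracketField_swap (X Y : VectorField m M) :
    lieBracketField X Y = - lieBracketField Y X := by
  ext x
  exact mlieBracket_swap_apply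

lemma lieBracketField_self (X : VectorField m M) : lieBracketField X X = 0 := by
  have h : (2 : ℝ) • lieBracketField X X = 0 := by
    rw [two_smul]
    nth_rw 1 [lieBracketField_swap]
    exact neg_add_cancel _
  exact (smul_eq_zero.1 h).resolve_left two_ne_zero

lemma lieBracketField_add_right (X Y Z : VectorField m M) :
    lieBracketField X (Y + Z) = lieBracketField X Y + lieBracketField X Z := by
  rw [lieBracketField_swap, lieBracketField_add_left, lieBracketField_swap X Y,
    lieBracketField_swap X Z, neg_add]

lemma lieBracketField_smul_left (c : ℝ) (X Y : VectorField m M) :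
    lieBracketField (c • X) Y = c • lieBracketField X Y := by
  have : IsManifold (𝓡 m) 2 M := .of_le (n := ∞) ENat.LEInfty.out
  ext x
  exact mlieBracket_const_smul_left (mdifferentiableAt_vectorField X x)

lemma lieBracketField_smulField_right (X : VectorField m M) (f : SmoothFun m M)
    (Y : VectorField m M) :
    lieBracketField X (smulField f Y) =
      smulField (derivAlong X f) Y + smulField f (lieBracketField X Y) := by
  have : IsManifold (𝓡 m) 2 M := .of_le (n := ∞) ENat.LEInfty.out
  ext x
  exact mlieBracket_smul_right (f.mdifferentiableAt) (mdifferentiableAt_vectorField Y x)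

/-- The Jacobi identity for smooth vector fields. -/
lemma lieBracketField_leibniz (X Y Z : VectorField m M) :
    lieBracketField X (lieBracketField Y Z) =
      lieBracketField (lieBracketField X Y) Z + lieBracketField Y (lieBracketField X Z) := by
  have : IsManifold (𝓡 m) (minSmoothness ℝ 3) M :=
    .of_le (n := ∞) (by simpa using ENat.LEInfty.out)
  have h2 : minSmoothness ℝ 2 ≤ ∞ := by simpa using ENat.LEInfty.out
  ext x
  exact leibniz_identity_mlieBracket_apply (X.contMDiff.of_le h2 x) (Y.contMDiff.of_le h2 x)
    (Z.contMDiff.of_le h2 x)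

/-- On a manifold with a nowhere vanishing vector field, the Lie bracket of vector fields is the
commutator of derivations. -/
lemma derivAlong_lieBracketField {Z : VectorField m M} (hZ : ∀ x, Z x ≠ 0)
    (X Y : VectorField m M) (f : SmoothFun m M) :
    derivAlong (lieBracketField X Y) f =
      derivAlong X (derivAlong Y f) - derivAlong Y (derivAlong X f) := by
  -- Expand the Jacobi identity for `X`, `Y`, `f Z`. Terms with one derivative on `f` and a bracket
  -- on `Z` cancel, and so does `f` times the Jacobi identity for `Z`; the remainder is the desired
  -- difference times `Z`.
  have h := lieBracketField_leibniz X Y (smulField f Z)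
  simp only [lieBracketField_smulField_right, lieBracketField_add_right] at h
  ext x
  have hx := congrArg (fun W : VectorField m M => W x) h
  have hj := congrArg (fun W : VectorField m M => f x • W x) (lieBracketField_leibniz X Y Z)
  simp only [ContMDiffSection.coe_add, Pi.add_apply, smulField_apply, smul_add] at hx hj
  rw [hj] at hx
  have h0 : (derivAlong (lieBracketField X Y) f x -
      (derivAlong X (derivAlong Y f) x - derivAlong Y (derivAlong X f) x)) • Z x = 0 := by
    linear_combination (norm := module) -hx
  exact sub_eq_zero.1 ((smul_eq_zero.1 h0).resolve_right (hZ x))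

end LieAlgebra

/-! ### The dual splittings and the contractions of `[X_p, X_q]`. -/

section Structure

variable {n : ℕ} {M : Type*} [TopologicalSpace M]
  [ChartedSpace (EuclideanSpace ℝ (Fin (2 * n + 1))) M] [IsManifold (𝓡 (2 * n + 1)) ∞ M]
  {ω₀ : OneForm (2 * n + 1) M} {Ω : TwoForm (2 * n + 1) M}
  {E : VectorField (2 * n + 1) M} {Λ : Bivector (2 * n + 1) M}

lemma IsDualPair.omega_sharp (h : IsDualPair ω₀ Ω E Λ) (x : M)
    (α : TangentSpace (𝓡 (2 * n + 1)) x →L[ℝ] ℝ) : ω₀ x (Λ.sharp x α) = 0 := by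
  rw [Λ.skew, h.Lambda_omega, map_zero, neg_zero]

lemma IsDualPair.flat_apply_E (h : IsDualPair ω₀ Ω E Λ) (x : M)
    (v : TangentSpace (𝓡 (2 * n + 1)) x) : Ω.flat x v (E x) = 0 := by
  rw [Ω.skew, h.Omega_E]
  simp

/-- The decomposition of tangent vectors along `im Λ♯` and `E`. -/
lemma IsDualPair.sharp_flat (h : IsDualPair ω₀ Ω E Λ) (h' : IsAlmostCosymplecticContact ω₀ Ω)
    (x : M) (v : TangentSpace (𝓡 (2 * n + 1)) x) :
    Λ.sharp x (Ω.flat x v) + ω₀ x v • E x = v := by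
  rw [← sub_eq_zero]
  -- Both `ω` and `Ω♭` annihilate the difference of the two sides.
  apply h'.eq_zero
  · rw [map_sub, map_add, map_smul, h.omega_sharp, h.omega_E]
    simp
  · rw [map_sub, map_add, map_smul, h.Omega_E, h.right_inv x _ ⟨v, rfl⟩]
    simp

/-- The decomposition of covectors along `im Ω♭` and `ω`. -/
lemma IsDualPair.flat_sharp (h : IsDualPair ω₀ Ω E Λ) (h' : IsAlmostCosymplecticContact ω₀ Ω)
    (x : M) (α : TangentSpace (𝓡 (2 * n + 1)) x →L[ℝ] ℝ) :
    Ω.flat x (Λ.sharp x α) = α - α (E x) • ω₀ x := by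
  refine ContinuousLinearMap.ext fun v => ?_
  -- This is the transpose of the splitting of vectors: moving `Λ♯` and then `Ω♭` across by
  -- skew-symmetry costs two signs, which cancel.
  have h1 : α v = α (Λ.sharp x (Ω.flat x v)) + ω₀ x v * α (E x) := by
    conv_lhs => rw [← h.sharp_flat h' x v, map_add, map_smul, smul_eq_mul]
  rw [Λ.skew, Ω.skew] at h1
  rw [sub_apply, smul_apply, smul_eq_mul, h1]
  ring

/-- The smooth vector field `X_{(α, h)}`. -/
def pairField (E : VectorField (2 * n + 1) M) (Λ : Bivector (2 * n + 1) M) :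
    FormFunPair (2 * n + 1) M →ₗ[ℝ] VectorField (2 * n + 1) M where
  toFun p := Λ.sharpField p.1 + smulField p.2 E
  map_add' p q := by
    ext x
    change Λ.sharp x (p.1 x + q.1 x) + (p.2 x + q.2 x) • E x =
      (Λ.sharp x (p.1 x) + p.2 x • E x) + (Λ.sharp x (q.1 x) + q.2 x • E x)
    rw [map_add, add_smul]
    abel
  map_smul' c p := by
    ext x
    change Λ.sharp x (c • p.1 x) + (c * p.2 x) • E x = c • (Λ.sharp x (p.1 x) + p.2 x • E x)
    rw [map_smul, smul_add, mul_smul]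

lemma coe_pairField (p : FormFunPair (2 * n + 1) M) : ⇑(pairField E Λ p) = genField E Λ p := rfl

/-- `Ω♭` kills `E`, so `h` drops out and only the part of `α` complementary to `ω` is recovered. -/
lemma IsDualPair.contract_pairField (h : IsDualPair ω₀ Ω E Λ)
    (h' : IsAlmostCosymplecticContact ω₀ Ω) (p : FormFunPair (2 * n + 1) M) :
    Ω.contract (pairField E Λ p) = p.1 - smulForm (pairing p.1 E) ω₀ := by
  refine ContMDiffSection.ext fun x => ?_
  change Ω.flat x (Λ.sharp x (p.1 x) + p.2 x • E x) = p.1 x - p.1 x (E x) • ω₀ x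
  rw [map_add, map_smul, h.Omega_E, h.flat_sharp h', smul_zero, add_zero]

lemma IsDualPair.omega_pairField (h : IsDualPair ω₀ Ω E Λ) (p : FormFunPair (2 * n + 1) M)
    (x : M) : ω₀ x (pairField E Λ p x) = p.2 x := by
  change ω₀ x (Λ.sharp x (p.1 x) + p.2 x • E x) = p.2 x
  rw [map_add, map_smul, h.omega_sharp, h.omega_E]
  simp

lemma IsDualPair.pairing_omega_pairField (h : IsDualPair ω₀ Ω E Λ)
    (p : FormFunPair (2 * n + 1) M) : pairing ω₀ (pairField E Λ p) = p.2 := by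
  ext x
  exact h.omega_pairField p x

/-- The term `d(ω(E))` vanishes because `ω(E)` is constant. -/
lemma IsDualPair.lieDer_omega (h : IsDualPair ω₀ Ω E Λ) (x : M) :
    lieDer E ω₀ x = dOne ω₀ x (E x) := by
  have : (fun y => ω₀ y (E y)) = fun _ => (1 : ℝ) := funext h.omega_E
  rw [lieDer, this, dFun, mfderiv_const]
  exact add_zero _

lemma dOne_self (α : OneForm (2 * n + 1) M) (x : M) (u : TangentSpace (𝓡 (2 * n + 1)) x) :
    dOne α x u u = 0 :=
  (dOne_apply x α u u).trans (sub_self _)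

lemma dOne_swap (α : OneForm (2 * n + 1) M) (x : M) (u v : TangentSpace (𝓡 (2 * n + 1)) x) :
    dOne α x u v = - dOne α x v u := by
  rw [dOne_apply x α u v, dOne_apply x α v u, neg_sub]

/-- The contraction of `ω` with the Lie bracket of two generated vector fields. -/
lemma IsDualPair.omega_mlieBracket (h : IsDualPair ω₀ Ω E Λ) (p q : FormFunPair (2 * n + 1) M)
    (x : M) :
    ω₀ x (mlieBracket (𝓡 (2 * n + 1)) (pairField E Λ p) (pairField E Λ q) x) =
      bracketFun ω₀ E Λ p q x := by
  rw [apply_mlieBracket, h.pairing_omega_pairField, h.pairing_omega_pairField]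
  simp only [bracketFun, Bivector.eval, h.lieDer_omega, coe_pairField, genField]
  -- The terms `Λ(L_E ω, α)` equal `-dω(E, α♯)`: they are the mixed terms of `dω(X_p, X_q)`.
  rw [Λ.skew x (dOne ω₀ x (E x)) (q.1 x), Λ.skew x (dOne ω₀ x (E x)) (p.1 x)]
  simp only [map_add, map_smul, add_apply, smul_apply, smul_eq_mul,
    dOne_self ω₀ x (E x)]
  rw [dOne_swap ω₀ x (Λ.sharp x (p.1 x)) (E x)]
  ring

/-- The contraction of `Ω` with the Lie bracket of two generated vector fields. -/
lemma IsDualPair.flat_mlieBracket (h : IsDualPair ω₀ Ω E Λ)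
    (h' : IsAlmostCosymplecticContact ω₀ Ω) (p q : FormFunPair (2 * n + 1) M) (x : M) :
    Ω.flat x (mlieBracket (𝓡 (2 * n + 1)) (pairField E Λ p) (pairField E Λ q) x) =
      bracketForm ω₀ E Λ p q x -
        (dFun (pairing q.1 E) x (pairField E Λ p x)
          - dFun (pairing p.1 E) x (pairField E Λ q x)) • ω₀ x := by
  rw [Ω.contract_mlieBracket (h'.closed x)]
  -- `Ω(X_q, X_p)` reduces to `Λ(α₁, α₂)`, as the contribution `h₁ α₂(E)` cancels against `α₂(E)
  -- ω(X_p)`.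
  have hΛ : pairing (Ω.contract (pairField E Λ q)) (pairField E Λ p) =
      (fun y => Λ.eval y (p.1 y) (q.1 y) : M → ℝ) := by
    funext y
    change Ω.contract (pairField E Λ q) y (pairField E Λ p y) = q.1 y (Λ.sharp y (p.1 y))
    rw [h.contract_pairField h']
    change q.1 y (pairField E Λ p y) - q.1 y (E y) * ω₀ y (pairField E Λ p y) = _
    rw [h.omega_pairField]
    change q.1 y (Λ.sharp y (p.1 y) + p.2 y • E y) - _ = _
    rw [map_add, map_smul, smul_eq_mul]
    ring
  rw [hΛ, h.contract_pairField h', h.contract_pairField h']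
  refine ContinuousLinearMap.ext fun w => ?_
  have hp : lieDer E p.1 x = dOne p.1 x (E x) + dFun (pairing p.1 E) x := rfl
  have hq : lieDer E q.1 x = dOne q.1 x (E x) + dFun (pairing q.1 E) x := rfl
  simp only [add_apply, sub_apply, smul_apply, smul_eq_mul]
  rw [dOne_sub_smulForm, dOne_sub_smulForm, h.omega_pairField, h.omega_pairField]
  simp only [bracketForm, hp, hq, h.lieDer_omega, coe_pairField, genField, pairing_apply,
    map_add, map_smul, add_apply, sub_apply, smul_apply, smul_eq_mul]
  ring

end Structure

/-! ### The Lie bracket of pairs. -/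

section Bracket

variable {n : ℕ} {M : Type*} [TopologicalSpace M]
  [ChartedSpace (EuclideanSpace ℝ (Fin (2 * n + 1))) M] [IsManifold (𝓡 (2 * n + 1)) ∞ M]
  {ω₀ : OneForm (2 * n + 1) M} {Ω : TwoForm (2 * n + 1) M}
  {E : VectorField (2 * n + 1) M} {Λ : Bivector (2 * n + 1) M}

/-- The function `α(E)` of a pair `(α, h)`. -/
def reebPart (E : VectorField (2 * n + 1) M) :
    FormFunPair (2 * n + 1) M →ₗ[ℝ] SmoothFun (2 * n + 1) M where
  toFun p := pairing p.1 E
  map_add' _ _ := rfl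
  map_smul' _ _ := rfl

/-- A pair `(α, h)` is determined by `X_{(α, h)}` and `α(E)`. -/
lemma IsDualPair.pair_ext (h : IsDualPair ω₀ Ω E Λ) (h' : IsAlmostCosymplecticContact ω₀ Ω)
    {p q : FormFunPair (2 * n + 1) M} (hX : pairField E Λ p = pairField E Λ q)
    (hE : reebPart E p = reebPart E q) : p = q := by
  refine Prod.ext ?_ ?_
  · have h1 := h.contract_pairField h' p
    rw [hX, h.contract_pairField h' q] at h1
    change q.1 - smulForm (reebPart E q) ω₀ = p.1 - smulForm (reebPart E p) ω₀ at h1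
    rw [hE] at h1
    exact (sub_left_injective h1).symm
  · rw [← h.pairing_omega_pairField p, hX, h.pairing_omega_pairField]

/-- The bracket of pairs, as a pair of a smooth 1-form and a smooth function. -/
def pairBracket (ω₀ : OneForm (2 * n + 1) M) (Ω : TwoForm (2 * n + 1) M)
    (E : VectorField (2 * n + 1) M) (Λ : Bivector (2 * n + 1) M)
    (p q : FormFunPair (2 * n + 1) M) : FormFunPair (2 * n + 1) M :=
  -- Solving `IsDualPair.flat_mlieBracket` for `β` writes it through smooth sections only, so
  -- smoothness of the bracket comes for free.
  (Ω.contract (lieBracketField (pairField E Λ p) (pairField E Λ q))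
    + smulForm (derivAlong (pairField E Λ p) (reebPart E q)
      - derivAlong (pairField E Λ q) (reebPart E p)) ω₀,
    pairing ω₀ (lieBracketField (pairField E Λ p) (pairField E Λ q)))

lemma IsDualPair.pairBracket_fst (h : IsDualPair ω₀ Ω E Λ)
    (h' : IsAlmostCosymplecticContact ω₀ Ω) (p q : FormFunPair (2 * n + 1) M) (x : M) :
    (pairBracket ω₀ Ω E Λ p q).1 x = bracketForm ω₀ E Λ p q x := by
  exact (sub_eq_iff_eq_add.1 (h.flat_mlieBracket h' p q x).symm).symm

lemma IsDualPair.pairBracket_snd (h : IsDualPair ω₀ Ω E Λ) (p q : FormFunPair (2 * n + 1) M)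
    (x : M) : (pairBracket ω₀ Ω E Λ p q).2 x = bracketFun ω₀ E Λ p q x :=
  h.omega_mlieBracket p q x

/-- Split the bracket along `im Λ♯` and `E`; the multiple of `ω` in its contraction with `Ω`
disappears under `Λ♯`. -/
lemma IsDualPair.mlieBracket_genField (h : IsDualPair ω₀ Ω E Λ)
    (h' : IsAlmostCosymplecticContact ω₀ Ω) (p q : FormFunPair (2 * n + 1) M) (x : M) :
    mlieBracket (𝓡 (2 * n + 1)) (genField E Λ p) (genField E Λ q) x =
      Λ.sharp x (bracketForm ω₀ E Λ p q x) + bracketFun ω₀ E Λ p q x • E x := by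
  have h1 := h.sharp_flat h' x
    (mlieBracket (𝓡 (2 * n + 1)) (pairField E Λ p) (pairField E Λ q) x)
  rw [h.flat_mlieBracket h', h.omega_mlieBracket, map_sub, map_smul, h.Lambda_omega, smul_zero,
    sub_zero] at h1
  exact h1.symm

lemma IsDualPair.pairField_pairBracket (h : IsDualPair ω₀ Ω E Λ)
    (h' : IsAlmostCosymplecticContact ω₀ Ω) (p q : FormFunPair (2 * n + 1) M) :
    pairField E Λ (pairBracket ω₀ Ω E Λ p q) =
      lieBracketField (pairField E Λ p) (pairField E Λ q) := by
  refine ContMDiffSection.ext fun x => ?_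
  refine Eq.trans ?_ (h.mlieBracket_genField h' p q x).symm
  rw [← h.pairBracket_fst h', ← h.pairBracket_snd]
  rfl

/-- `Ω♭` takes values annihilating `E`, and `ω(E) = 1`, so evaluating at `E` reads off the
coefficient of `ω`. -/
lemma IsDualPair.reebPart_pairBracket (h : IsDualPair ω₀ Ω E Λ) (p q : FormFunPair (2 * n + 1) M) :
    reebPart E (pairBracket ω₀ Ω E Λ p q) =
      derivAlong (pairField E Λ p) (reebPart E q)
        - derivAlong (pairField E Λ q) (reebPart E p) := by
  ext x
  change Ω.flat x _ (E x) + _ * ω₀ x (E x) = _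
  rw [h.flat_apply_E, h.omega_E, zero_add, mul_one]

/-- The bracket of pairs as a bilinear map. -/
def IsDualPair.bracket (h : IsDualPair ω₀ Ω E Λ) (h' : IsAlmostCosymplecticContact ω₀ Ω) :
    FormFunPair (2 * n + 1) M →ₗ[ℝ] FormFunPair (2 * n + 1) M →ₗ[ℝ] FormFunPair (2 * n + 1) M :=
  have hswap : ∀ p q, pairBracket ω₀ Ω E Λ p q = - pairBracket ω₀ Ω E Λ q p := by
    intro p q
    apply h.pair_ext h'
    · rw [map_neg, h.pairField_pairBracket h', h.pairField_pairBracket h', lieBracketField_swap]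
    · rw [map_neg, h.reebPart_pairBracket, h.reebPart_pairBracket, neg_sub]
  have hadd : ∀ p p' q, pairBracket ω₀ Ω E Λ (p + p') q =
      pairBracket ω₀ Ω E Λ p q + pairBracket ω₀ Ω E Λ p' q := by
    intro p p' q
    apply h.pair_ext h'
    · simp only [map_add, h.pairField_pairBracket h', lieBracketField_add_left]
    · simp only [map_add, h.reebPart_pairBracket, derivAlong_add_left, derivAlong_add_right]
      abel
  have hsmul : ∀ (c : ℝ) p q, pairBracket ω₀ Ω E Λ (c • p) q = c • pairBracket ω₀ Ω E Λ p q := by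
    intro c p q
    apply h.pair_ext h'
    · simp only [map_smul, h.pairField_pairBracket h', lieBracketField_smul_left]
    · simp only [map_smul, h.reebPart_pairBracket, derivAlong_smul_left, derivAlong_smul_right,
        smul_sub]
  LinearMap.mk₂ ℝ (pairBracket ω₀ Ω E Λ) hadd hsmul
    (fun p q q' => by rw [hswap, hadd, hswap p q, hswap p q', neg_add])
    (fun c p q => by rw [hswap, hsmul, hswap p q, smul_neg])

lemma IsDualPair.bracket_apply (h : IsDualPair ω₀ Ω E Λ) (h' : IsAlmostCosymplecticContact ω₀ Ω)
    (p q : FormFunPair (2 * n + 1) M) : h.bracket h' p q = pairBracket ω₀ Ω E Λ p q := rfl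

lemma IsDualPair.bracket_self (h : IsDualPair ω₀ Ω E Λ) (h' : IsAlmostCosymplecticContact ω₀ Ω)
    (p : FormFunPair (2 * n + 1) M) : h.bracket h' p p = 0 := by
  apply h.pair_ext h'
  · rw [h.bracket_apply, h.pairField_pairBracket h', lieBracketField_self, map_zero]
  · rw [h.bracket_apply, h.reebPart_pairBracket, sub_self, map_zero]

lemma IsDualPair.E_ne_zero (h : IsDualPair ω₀ Ω E Λ) (x : M) : E x ≠ 0 := by
  intro h0
  have h1 := h.omega_E x
  rw [h0, map_zero] at h1
  exact zero_ne_one h1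

/-- By `IsDualPair.pair_ext` two components are checked: the field part is the Jacobi identity for
vector fields, and the function part holds because `[X, Y]` acts as a commutator, `E` being the
nowhere vanishing field required there. -/
lemma IsDualPair.bracket_jacobi (h : IsDualPair ω₀ Ω E Λ) (h' : IsAlmostCosymplecticContact ω₀ Ω)
    (p q r : FormFunPair (2 * n + 1) M) :
    h.bracket h' p (h.bracket h' q r) + h.bracket h' q (h.bracket h' r p)
      + h.bracket h' r (h.bracket h' p q) = 0 := by
  have hsub : ∀ (X : VectorField (2 * n + 1) M) (f g : SmoothFun (2 * n + 1) M),
      derivAlong X (f - g) = derivAlong X f - derivAlong X g := by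
    intro X f g
    rw [eq_sub_iff_add_eq, ← derivAlong_add_right, sub_add_cancel]
  have hneg : ∀ X Y : VectorField (2 * n + 1) M,
      lieBracketField X (-Y) = - lieBracketField X Y := by
    intro X Y
    rw [lieBracketField_swap, ← neg_one_smul ℝ Y, lieBracketField_smul_left, neg_one_smul, neg_neg,
      lieBracketField_swap]
  apply h.pair_ext h'
  · simp only [h.bracket_apply, map_add, h.pairField_pairBracket h', map_zero]
    rw [lieBracketField_leibniz, lieBracketField_swap _ (pairField E Λ p),
      lieBracketField_swap _ (pairField E Λ r), hneg]
    abel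
  · simp only [h.bracket_apply, map_add, h.pairField_pairBracket h', h.reebPart_pairBracket,
      derivAlong_lieBracketField h.E_ne_zero, hsub, map_zero]
    abel

/-- The bracket at `x` involves only the germs at `x` of the generated fields and of the functions
`α(E)`, and the open set `U` is a neighbourhood of `x`. -/
lemma IsDualPair.bracket_congr (h : IsDualPair ω₀ Ω E Λ) (h' : IsAlmostCosymplecticContact ω₀ Ω)
    {U : Set M} (hU : IsOpen U) {p q p' q' : FormFunPair (2 * n + 1) M}
    (hp : ∀ x ∈ U, p.1 x = p'.1 x ∧ p.2 x = p'.2 x)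
    (hq : ∀ x ∈ U, q.1 x = q'.1 x ∧ q.2 x = q'.2 x) {x : M} (hx : x ∈ U) :
    (h.bracket h' p q).1 x = (h.bracket h' p' q').1 x ∧
      (h.bracket h' p q).2 x = (h.bracket h' p' q').2 x := by
  have hfield : ∀ {p p' : FormFunPair (2 * n + 1) M},
      (∀ x ∈ U, p.1 x = p'.1 x ∧ p.2 x = p'.2 x) →
      (pairField E Λ p : ∀ y : M, TangentSpace (𝓡 (2 * n + 1)) y) =ᶠ[nhds x]
        pairField E Λ p' := by
    intro p p' hp
    filter_upwards [hU.mem_nhds hx] with y hy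
    rw [coe_pairField, coe_pairField, genField, genField, (hp y hy).1, (hp y hy).2]
  have hreeb : ∀ {p p' : FormFunPair (2 * n + 1) M},
      (∀ x ∈ U, p.1 x = p'.1 x ∧ p.2 x = p'.2 x) →
      (dFun (reebPart E p) x : TangentSpace (𝓡 (2 * n + 1)) x →L[ℝ] ℝ) =
        dFun (reebPart E p') x := by
    intro p p' hp
    have : (reebPart E p : M → ℝ) =ᶠ[nhds x] reebPart E p' := by
      filter_upwards [hU.mem_nhds hx] with y hy
      exact congrArg (fun α => α (E y)) (hp y hy).1
    exact this.mfderiv_eq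
  have hlie : mlieBracket (𝓡 (2 * n + 1)) (pairField E Λ p) (pairField E Λ q) x =
      mlieBracket (𝓡 (2 * n + 1)) (pairField E Λ p') (pairField E Λ q') x :=
    (hfield hp).mlieBracket_vectorField_eq (hfield hq)
  refine ⟨?_, congrArg (ω₀ x) hlie⟩
  change Ω.flat x (mlieBracket (𝓡 (2 * n + 1)) (pairField E Λ p) (pairField E Λ q) x)
      + (dFun (reebPart E q) x (pairField E Λ p x)
        - dFun (reebPart E p) x (pairField E Λ q x)) • ω₀ x =
    Ω.flat x (mlieBracket (𝓡 (2 * n + 1)) (pairField E Λ p') (pairField E Λ q') x)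
      + (dFun (reebPart E q') x (pairField E Λ p' x)
        - dFun (reebPart E p') x (pairField E Λ q' x)) • ω₀ x
  rw [hlie, hreeb hp, hreeb hq, (hfield hp).eq_of_nhds, (hfield hq).eq_of_nhds]

end Bracket

end AlmostCosymplecticContact

end

open AlmostCosymplecticContact in
theorem lemma2p1 (n : ℕ) (M : Type*) [TopologicalSpace M] [T2Space M]
    [SecondCountableTopology M] [ChartedSpace (EuclideanSpace ℝ (Fin (2 * n + 1))) M]
    [IsManifold (𝓡 (2 * n + 1)) ∞ M]
    (ω₀ : OneForm (2 * n + 1) M) (Ω : TwoForm (2 * n + 1) M)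
    (E : VectorField (2 * n + 1) M) (Λ : Bivector (2 * n + 1) M)
    (hωΩ : IsAlmostCosymplecticContact ω₀ Ω) (hdual : IsDualPair ω₀ Ω E Λ) :
    -- the Lie bracket of the vector fields generated by two pairs
    (∀ (p q : FormFunPair (2 * n + 1) M) (x : M),
      VectorField.mlieBracket (𝓡 (2 * n + 1)) (genField E Λ p) (genField E Λ q) x
        = Λ.sharp x (bracketForm ω₀ E Λ p q x) + bracketFun ω₀ E Λ p q x • E x) ∧
    -- the bracket of pairs
    ∃ br : FormFunPair (2 * n + 1) M →ₗ[ℝ] FormFunPair (2 * n + 1) M →ₗ[ℝ]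
        FormFunPair (2 * n + 1) M,
      (∀ (p q : FormFunPair (2 * n + 1) M) (x : M),
        (br p q).1 x = bracketForm ω₀ E Λ p q x ∧ (br p q).2 x = bracketFun ω₀ E Λ p q x) ∧
      (∀ p : FormFunPair (2 * n + 1) M, br p p = 0) ∧
      (∀ p q r : FormFunPair (2 * n + 1) M,
        br p (br q r) + br q (br r p) + br r (br p q) = 0) ∧
      (∀ (p q : FormFunPair (2 * n + 1) M) (x : M),
        genField E Λ (br p q) x
          = VectorField.mlieBracket (𝓡 (2 * n + 1)) (genField E Λ p) (genField E Λ q) x) ∧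
      -- compatibility with restriction to open subsets
      (∀ (U : Set M), IsOpen U → ∀ p q p' q' : FormFunPair (2 * n + 1) M,
        (∀ x ∈ U, p.1 x = p'.1 x ∧ p.2 x = p'.2 x) →
        (∀ x ∈ U, q.1 x = q'.1 x ∧ q.2 x = q'.2 x) →
        ∀ x ∈ U, (br p q).1 x = (br p' q').1 x ∧ (br p q).2 x = (br p' q').2 x) := by
  refine ⟨hdual.mlieBracket_genField hωΩ, hdual.bracket hωΩ,
    fun p q x => ⟨hdual.pairBracket_fst hωΩ p q x, hdual.pairBracket_snd p q x⟩,
    hdual.bracket_self hωΩ, hdual.bracket_jacobi hωΩ, fun p q x => ?_,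
    fun U hU p q p' q' hp hq x hx => hdual.bracket_congr hωΩ hU hp hq hx⟩
  exact congrArg (fun X : VectorField (2 * n + 1) M => X x)
    (hdual.pairField_pairBracket hωΩ p q)
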